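/- Theorem 2. Let $k$ be an infinite field and let $V_\bullet = (V_i, d_i\colon V_i\to V_{i+1})_{i\in\mathbb{Z}}$ be a cochain complex of finite-dimensional $k$-vector spaces. Suppose that $V_\bullet$ is quasi-bounded, meaning that $d_i = 0$ for at least one index $i\in\mathbb{Z}$. Let $\phi_\bullet\colon V_\bullet\to V_\bullet$ be an endomorphism of the complex, and for each $i$ let $\phi_i^H\colon H^i(V_\bullet)\to H^i(V_\bullet)$ be the induced map on cohomology. Then the following are equivalent: a) $\phi_\bullet$ is a commutator in the endomorphism ring of the complex $V_\bullet$, i.e. there are endomorphisms $\alpha_\bullet,\beta_\bullet$ of $V_\bullet$ with $\phi_\bullet=\alpha_\bullet\beta_\bullet-\beta_\bullet\alpha_\bullet$; b) $\operatorname{tr}(\phi_i)=0$ and $\operatorname{tr}(\phi_i^H)=0$ for every $i\in\mathbb{Z}$. -/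

import Mathlib

universe v u

namespace EndComplex

open CategoryTheory


/-- An element of a ring is a commutator if it is of the form `a * b - b * a`. -/
def IsRingCommutator {R : Type*} [Ring R] (x : R) : Prop :=
  ∃ a b : R, x = a * b - b * a

variable {k : Type u} [Field k]

/-- A cochain complex (indexed by `ℤ`, with `d i : V i → V (i + 1)`) is quasi-bounded if at least
one of its differentials is the zero map. -/
def IsQuasiBounded (V : CochainComplex (ModuleCat.{v} k) ℤ) : Prop :=
  ∃ i : ℤ, V.d i (i + 1) = 0

/-- An endomorphism of a complex is a commutator if it is a commutator in the endomorphism ring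
of the complex. -/
def IsCommutator {V : CochainComplex (ModuleCat.{v} k) ℤ} (φ : V ⟶ V) : Prop :=
  IsRingCommutator (R := End V) φ

/-- The trace of the component `φ i : V i → V i`. -/
noncomputable def tr {V : CochainComplex (ModuleCat.{v} k) ℤ} (φ : V ⟶ V) (i : ℤ) : k :=
  LinearMap.trace k (V.X i) (φ.f i).hom

/-- The trace of the map induced by `φ` on the cohomology `H^i(V)`. -/
noncomputable def trH {V : CochainComplex (ModuleCat.{v} k) ℤ} (φ : V ⟶ V) (i : ℤ) : k :=
  LinearMap.trace k (V.homology i) (HomologicalComplex.homologyMap φ i).hom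

end EndComplex

/-! Let B_i be the coboundaries. Split V_i = B_i ⊕ H_i ⊕ B_{i+1}, so that d_i is the projection to
the last summand followed by its inclusion in V_{i+1}. Endomorphisms of the complex are then
families of block upper triangular maps with diagonal blocks b_i, h_i, b_{i+1}, where b_i is shared
by neighbouring degrees and the blocks above the diagonal are arbitrary. The trace of h_i is the
trace on cohomology. If all tr φ_i and tr h_i vanish, then tr b_i + tr b_{i+1} = 0; a zero
differential gives some b_{j+1} = 0, and the vanishing of tr b_i spreads to all degrees. Trace-zero
blocks are commutators, b_i = [X_i, Z_i] and h_i = [Y_i, W_i]. Adding scalars to X_i and Y_i does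
not affect this. As k is infinite, scalars exist that make every Sylvester equation between X_i,
Y_i, X_{i+1} solvable. Then φ = [α, β] with α block diagonal, the blocks of β above the diagonal
being the solutions (`exists_eq_diag_commutator`). -/

namespace EndComplex

/-! ### Sylvester equations and trace-zero endomorphisms -/

section LinearAlgebra

variable {k : Type*} [Field k]
variable {E F : Type*} [AddCommGroup E] [Module k E] [AddCommGroup F] [Module k F]

/-- The Sylvester equation `X U - U Y = P` is solvable for every right-hand side. -/
def SylvesterSolvable (X : Module.End k E) (Y : Module.End k F) : Prop :=
  ∀ P : F →ₗ[k] E, ∃ U : F →ₗ[k] E, X ∘ₗ U - U ∘ₗ Y = P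

lemma SylvesterSolvable.add_smul_one {X : Module.End k E} {Y : Module.End k F} {a b : k}
    (h : SylvesterSolvable (X + (a - b) • 1) Y) :
    SylvesterSolvable (X + a • 1) (Y + b • 1) := by
  intro P
  obtain ⟨U, hU⟩ := h P
  refine ⟨U, ?_⟩
  rw [← hU]
  ext x
  simp [sub_smul]
  abel

lemma finite_not_surjective_add_smul_one [FiniteDimensional k E] (L : Module.End k E) :
    {t : k | ¬ Function.Surjective (L + t • (1 : Module.End k E))}.Finite := by
  refine ((-L).finite_hasEigenvalue).subset fun t ht => ?_
  rw [Set.mem_ofPred_eq, Module.End.hasEigenvalue_iff]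
  rw [Set.mem_ofPred_eq, ← LinearMap.injective_iff_surjective, ← LinearMap.ker_eq_bot] at ht
  intro h
  apply ht
  rw [eq_bot_iff, ← h]
  intro x hx
  rw [Module.End.mem_eigenspace_iff]
  have : L x + t • x = 0 := by simpa using hx
  rw [LinearMap.neg_apply]
  exact neg_eq_of_add_eq_zero_right this

/-- Shifting X by t shifts the operator U ↦ XU - UY by t, and L + t fails to be onto only when t is
an eigenvalue of -L. -/
lemma finite_not_sylvesterSolvable [FiniteDimensional k E] [FiniteDimensional k F]
    (X : Module.End k E) (Y : Module.End k F) :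
    {t : k | ¬ SylvesterSolvable (X + t • 1) Y}.Finite := by
  let L : Module.End k (F →ₗ[k] E) :=
    { toFun U := X ∘ₗ U - U ∘ₗ Y
      map_add' U U' := by ext; simp; abel
      map_smul' c U := by ext; simp [smul_sub] }
  refine (finite_not_surjective_add_smul_one L).subset fun t ht h => ht fun P => ?_
  obtain ⟨U, hU⟩ := h P
  refine ⟨U, ?_⟩
  rw [← hU]
  ext x
  simp [L]
  abel

lemma finite_not_sylvesterSolvable_right [FiniteDimensional k E] [FiniteDimensional k F]
    (X : Module.End k E) (Y : Module.End k F) :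
    {t : k | ¬ SylvesterSolvable X (Y + t • 1)}.Finite := by
  refine ((finite_not_sylvesterSolvable X Y).preimage neg_injective.injOn).subset fun t ht h => ht ?_
  intro P
  obtain ⟨U, hU⟩ := h P
  refine ⟨U, ?_⟩
  rw [← hU]
  ext x
  simp
  abel

/-- Multiplication by `x` and derivation on `k[x] / (x ^ n)`, when `n = 0` in `k`. -/
lemma isRingCommutator_one_of_finrank_eq_zero [FiniteDimensional k E]
    (h : (Module.finrank k E : k) = 0) : IsRingCommutator (1 : Module.End k E) := by
  obtain ⟨n, hn⟩ : ∃ n, n = Module.finrank k E := ⟨_, rfl⟩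
  let b := Module.finBasisOfFinrankEq k E hn.symm
  rw [← hn] at h
  let S : Module.End k E := b.constr k fun j => if hj : j.1 + 1 < n then b ⟨j.1 + 1, hj⟩ else 0
  -- The truncated index at j = 0 is harmless, since its coefficient is 0.
  let D : Module.End k E := b.constr k fun j => (j.1 : k) • b ⟨j.1 - 1, by omega⟩
  refine ⟨D, S, b.ext fun j => ?_⟩
  have hS (j) : S (b j) = if hj : j.1 + 1 < n then b ⟨j.1 + 1, hj⟩ else 0 := b.constr_basis k _ j
  have hD (j) : D (b j) = (j.1 : k) • b ⟨j.1 - 1, by omega⟩ := b.constr_basis k _ j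
  have h2 : S (D (b j)) = (j.1 : k) • b j := by
    rw [hD, map_smul, hS]
    rcases Nat.eq_zero_or_pos j.1 with h0 | h0
    · simp [h0]
    · rw [dif_pos (by have := j.2; simp only; omega)]
      congr 2
      ext
      simp only
      omega
  simp only [Module.End.one_apply, LinearMap.sub_apply, Module.End.mul_apply, h2]
  rw [hS]
  split_ifs with hj
  · rw [hD]
    simp [add_smul]
  -- On the top basis vector `S` vanishes, and -SD contributes -(n - 1), which is 1 because n = 0 in
  -- k.
  · have : ((j.1 + 1 : ℕ) : k) = 0 := by
      have := j.2
      rw [← h]; congr 1; omega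
    have h3 : (j.1 : k) = -1 := by
      push_cast at this
      exact eq_neg_of_add_eq_zero_left this
    simp [h3]

lemma isRingCommutator_smul {R : Type*} [Ring R] [Algebra k R] {x : R} (c : k)
    (h : IsRingCommutator x) : IsRingCommutator (c • x) := by
  obtain ⟨a, b, rfl⟩ := h
  exact ⟨c • a, b, by simp [smul_sub]⟩

lemma exists_dual_eq_one_apply_eq_zero {v w : E} (h : LinearIndependent k ![v, w]) :
    ∃ f : E →ₗ[k] k, f v = 1 ∧ f w = 0 := by
  have hv : v ∉ Submodule.span k {w} := by
    intro hv
    obtain ⟨a, ha⟩ := Submodule.mem_span_singleton.mp hv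
    have := LinearIndependent.pair_iff.mp h 1 (-a) (by rw [← ha]; simp)
    exact one_ne_zero this.1
  obtain ⟨f, hf, hle⟩ := Submodule.exists_le_ker_of_notMem hv
  have hw : f w = 0 := hle (Submodule.mem_span_singleton_self w)
  exact ⟨(f v)⁻¹ • f, by simp [hf], by simp [hw]⟩

lemma trace_eq_trace_ker_of_apply_eq_zero [FiniteDimensional k E] (A : Module.End k E)
    {v : E} {f : E →ₗ[k] k} {W : Type*} [AddCommGroup W] [Module k W] [FiniteDimensional k W]
    (j : W →ₗ[k] E) (q : E →ₗ[k] W) (hfA : f (A v) = 0) (hdec : ∀ x, f x • v + j (q x) = x) :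
    LinearMap.trace k W (q ∘ₗ A ∘ₗ j) = LinearMap.trace k E A := by
  have h1 : A = (A ∘ₗ LinearMap.toSpanSingleton k E v) ∘ₗ f + (A ∘ₗ j) ∘ₗ q := by
    ext x
    conv_lhs => rw [← hdec x]
    simp
  conv_rhs => rw [h1]
  rw [map_add, LinearMap.trace_comp_comm' f, LinearMap.trace_comp_comm' q]
  have : f ∘ₗ A ∘ₗ LinearMap.toSpanSingleton k E v = 0 := by
    ext; simp [hfA]
  rw [this]
  simp

/-- If A is not a scalar, some v and Av are independent, and a complement W of v containing Av makes
the corner entry of A zero. By induction the W-block is [X, Z]; with X shifted to be invertible, the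
commutator with 0 ⊕ X reaches any off-diagonal entries. If A is a scalar a, then a · dim E = 0 in k.
-/
lemma isRingCommutator_of_finrank_eq_of_trace_eq_zero [Infinite k] (n : ℕ) :
    ∀ {E : Type*} [AddCommGroup E] [Module k E] [FiniteDimensional k E] (A : Module.End k E),
      Module.finrank k E = n → LinearMap.trace k E A = 0 → IsRingCommutator A := by
  induction n with
  | zero =>
    intro E _ _ _ A hn _
    have := Module.finrank_zero_iff.mp hn
    exact ⟨0, 0, LinearMap.ext fun x => Subsingleton.elim _ _⟩
  | succ n ih =>
    intro E _ _ _ A hn hA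
    by_cases hind : ∃ v, LinearIndependent k ![v, A v]
    · obtain ⟨v, hv⟩ := hind
      obtain ⟨f, hfv, hfA⟩ := exists_dual_eq_one_apply_eq_zero hv
      let W := LinearMap.ker f
      let j : W →ₗ[k] E := W.subtype
      let q : E →ₗ[k] W := LinearMap.codRestrict W
        (LinearMap.id - (LinearMap.toSpanSingleton k E v) ∘ₗ f) (by intro x; simp [W, hfv])
      have hdec (x : E) : f x • v + j (q x) = x := by simp [j, q]
      have hfj (w : W) : f (j w) = 0 := w.2
      have hqj (w : W) : q (j w) = w := by
        apply Subtype.ext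
        have := hdec (j w)
        rwa [hfj, zero_smul, zero_add] at this
      have hqv : q v = 0 := by
        apply Subtype.ext
        simp [q, hfv]
      have hW : Module.finrank k W = n := by
        have h1 := LinearMap.finrank_range_add_finrank_ker f
        have h2 : LinearMap.range f = ⊤ :=
          LinearMap.range_eq_top.mpr fun c => ⟨c • v, by simp [hfv]⟩
        rw [h2, finrank_top, Module.finrank_self, hn] at h1
        change 1 + Module.finrank k W = _ at h1
        omega
      obtain ⟨X₀, Z, hB⟩ := ih (q ∘ₗ A ∘ₗ j) hW
        ((trace_eq_trace_ker_of_apply_eq_zero A j q hfA hdec).trans hA)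
      -- The off-diagonal row and column equations are Sylvester equations between X and the zero
      -- corner.
      obtain ⟨t, ht⟩ := Set.Finite.exists_notMem
        ((finite_not_sylvesterSolvable X₀ (0 : Module.End k k)).union
          (finite_not_sylvesterSolvable_right (0 : Module.End k k) X₀))
      rw [Set.mem_union, not_or, Set.mem_ofPred_eq, Set.mem_ofPred_eq, not_not, not_not] at ht
      obtain ⟨X, hX⟩ : ∃ X, X = X₀ + t • 1 := ⟨_, rfl⟩
      obtain ⟨c, hc⟩ := ht.1 (q ∘ₗ A ∘ₗ LinearMap.toSpanSingleton k E v)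
      obtain ⟨r, hr⟩ := ht.2 (f ∘ₗ A ∘ₗ j)
      rw [← hX] at hc hr
      have hB' (w) : X (Z w) - Z (X w) = q (A (j w)) := by
        have := LinearMap.congr_fun hB w
        simp at this
        simp [this, hX]
      have hc' (a : k) : X (c a) = a • q (A v) := by
        simpa using LinearMap.congr_fun hc a
      have hr' (w) : - r (X w) = f (A (j w)) := by
        simpa using LinearMap.congr_fun hr w
      refine ⟨j ∘ₗ X ∘ₗ q, j ∘ₗ Z ∘ₗ q + j ∘ₗ c ∘ₗ f +
        LinearMap.toSpanSingleton k E v ∘ₗ r ∘ₗ q, ?_⟩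
      ext x
      have h1 : A x = f x • j (q (A v)) + (f (A (j (q x))) • v + j (q (A (j (q x))))) := by
        rw [hdec]
        have := hdec (A v)
        rw [hfA, zero_smul, zero_add] at this
        rw [this]
        conv_lhs => rw [← hdec x]
        simp
      rw [h1, ← hB', ← hr', ← map_smul, ← hc']
      simp only [LinearMap.sub_apply, Module.End.mul_apply, LinearMap.comp_apply,
        LinearMap.add_apply, map_add, hqj, map_sub, hfj, map_zero, add_zero,
        LinearMap.toSpanSingleton_apply, map_smul, hqv, smul_zero, neg_smul]
      abel
    · push Not at hind
      obtain ⟨a, rfl⟩ := A.exists_eq_smul_id_of_forall_notLinearIndependent hind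
      by_cases ha : a = 0
      · exact ⟨0, 0, by simp [ha]⟩
      · refine isRingCommutator_smul a (isRingCommutator_one_of_finrank_eq_zero ?_)
        have : a * (Module.finrank k E : k) = 0 := by simpa using hA
        exact (mul_eq_zero.mp this).resolve_left ha

/-- Over an infinite field every endomorphism of trace zero is a commutator. -/
theorem isRingCommutator_of_trace_eq_zero [Infinite k] [FiniteDimensional k E]
    (A : Module.End k E) (hA : LinearMap.trace k E A = 0) : IsRingCommutator A :=
  isRingCommutator_of_finrank_eq_of_trace_eq_zero _ A rfl hA

end LinearAlgebra

/-! ### Three-block decompositions -/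

section Splitting

variable {k : Type*} [Field k]

/-- A decomposition of `V` as a direct sum of `B`, `H` and `C`. -/
structure TriSplitting (k V B H C : Type*) [Field k] [AddCommGroup V] [Module k V]
    [AddCommGroup B] [Module k B] [AddCommGroup H] [Module k H] [AddCommGroup C] [Module k C] where
  inB : B →ₗ[k] V
  inH : H →ₗ[k] V
  inC : C →ₗ[k] V
  prB : V →ₗ[k] B
  prH : V →ₗ[k] H
  prC : V →ₗ[k] C
  prB_inB : ∀ x, prB (inB x) = x
  prB_inH : ∀ x, prB (inH x) = 0
  prB_inC : ∀ x, prB (inC x) = 0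
  prH_inB : ∀ x, prH (inB x) = 0
  prH_inH : ∀ x, prH (inH x) = x
  prH_inC : ∀ x, prH (inC x) = 0
  prC_inB : ∀ x, prC (inB x) = 0
  prC_inH : ∀ x, prC (inH x) = 0
  prC_inC : ∀ x, prC (inC x) = x
  sum_eq : ∀ x, inB (prB x) + inH (prH x) + inC (prC x) = x

namespace TriSplitting

attribute [simp] prB_inB prB_inH prB_inC prH_inB prH_inH prH_inC prC_inB prC_inH prC_inC

variable {V B H C : Type*} [AddCommGroup V] [Module k V]
    [AddCommGroup B] [Module k B] [AddCommGroup H] [Module k H] [AddCommGroup C] [Module k C]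
    (S : TriSplitting k V B H C)

lemma trace_eq [FiniteDimensional k V] [FiniteDimensional k B] [FiniteDimensional k H]
    [FiniteDimensional k C] (φ : Module.End k V) :
    LinearMap.trace k V φ = LinearMap.trace k B (S.prB ∘ₗ φ ∘ₗ S.inB) +
      LinearMap.trace k H (S.prH ∘ₗ φ ∘ₗ S.inH) + LinearMap.trace k C (S.prC ∘ₗ φ ∘ₗ S.inC) := by
  have h : φ = (φ ∘ₗ S.inB) ∘ₗ S.prB + (φ ∘ₗ S.inH) ∘ₗ S.prH + (φ ∘ₗ S.inC) ∘ₗ S.prC := by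
    ext x
    conv_lhs => rw [← S.sum_eq x]
    simp
  conv_lhs => rw [h]
  rw [map_add, map_add, LinearMap.trace_comp_comm' S.prB, LinearMap.trace_comp_comm' S.prH,
    LinearMap.trace_comp_comm' S.prC]

/-- The block diagonal endomorphism with given diagonal blocks. -/
def diag (X : Module.End k B) (Y : Module.End k H) (X' : Module.End k C) : Module.End k V :=
  S.inB ∘ₗ X ∘ₗ S.prB + S.inH ∘ₗ Y ∘ₗ S.prH + S.inC ∘ₗ X' ∘ₗ S.prC

/-- A block upper triangular endomorphism whose diagonal blocks are commutators `[X, Z]`, `[Y, W]`,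
`[X', Z']` is the commutator of a block diagonal endomorphism with a block upper triangular one,
provided that the Sylvester equations between the diagonal blocks are solvable. -/
lemma exists_eq_diag_commutator (φ : Module.End k V)
    (hHB : ∀ x, S.prH (φ (S.inB x)) = 0) (hCB : ∀ x, S.prC (φ (S.inB x)) = 0)
    (hCH : ∀ x, S.prC (φ (S.inH x)) = 0)
    {X Z : Module.End k B} {Y W : Module.End k H} {X' Z' : Module.End k C}
    (hB : S.prB ∘ₗ φ ∘ₗ S.inB = X * Z - Z * X) (hH : S.prH ∘ₗ φ ∘ₗ S.inH = Y * W - W * Y)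
    (hC : S.prC ∘ₗ φ ∘ₗ S.inC = X' * Z' - Z' * X')
    (hXY : SylvesterSolvable X Y) (hXX : SylvesterSolvable X X') (hYX : SylvesterSolvable Y X') :
    ∃ β : Module.End k V, φ = S.diag X Y X' * β - β * S.diag X Y X' ∧
      (∀ x, β (S.inB x) = S.inB (Z x)) ∧ ∀ x, S.prC (β x) = Z' (S.prC x) := by
  -- Bracketing with a block diagonal map acts on each block separately, by the Sylvester operator
  -- of the two diagonal blocks concerned.
  obtain ⟨P, hP⟩ := hXY (S.prB ∘ₗ φ ∘ₗ S.inH)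
  obtain ⟨Q, hQ⟩ := hXX (S.prB ∘ₗ φ ∘ₗ S.inC)
  obtain ⟨R, hR⟩ := hYX (S.prH ∘ₗ φ ∘ₗ S.inC)
  have hB (x) : S.prB (φ (S.inB x)) = X (Z x) - Z (X x) := LinearMap.congr_fun hB x
  have hH (x) : S.prH (φ (S.inH x)) = Y (W x) - W (Y x) := LinearMap.congr_fun hH x
  have hC (x) : S.prC (φ (S.inC x)) = X' (Z' x) - Z' (X' x) := LinearMap.congr_fun hC x
  have hP (x) : S.prB (φ (S.inH x)) = X (P x) - P (Y x) := (LinearMap.congr_fun hP x).symm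
  have hQ (x) : S.prB (φ (S.inC x)) = X (Q x) - Q (X' x) := (LinearMap.congr_fun hQ x).symm
  have hR (x) : S.prH (φ (S.inC x)) = Y (R x) - R (X' x) := (LinearMap.congr_fun hR x).symm
  refine ⟨S.diag Z W Z' + S.inB ∘ₗ P ∘ₗ S.prH + S.inB ∘ₗ Q ∘ₗ S.prC + S.inH ∘ₗ R ∘ₗ S.prC,
    LinearMap.ext fun x => ?_, fun x => by simp [diag], fun x => by simp [diag]⟩
  have h1 : φ x = φ (S.inB (S.prB x)) + φ (S.inH (S.prH x)) + φ (S.inC (S.prC x)) := by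
    rw [← map_add, ← map_add, S.sum_eq]
  rw [h1, ← S.sum_eq (φ (S.inB (S.prB x))), ← S.sum_eq (φ (S.inH (S.prH x))),
    ← S.sum_eq (φ (S.inC (S.prC x)))]
  simp only [hB, hH, hC, hP, hQ, hR, hHB, hCB, hCH]
  simp [diag]
  abel

/-- The decomposition attached to `B` embedded in `V` and `V` mapping onto `C`, with composition
zero. -/
lemma exists_of_comp_eq_zero (i : B →ₗ[k] V) (hi : Function.Injective i) (p : V →ₗ[k] C)
    (hp : Function.Surjective p) (hpi : ∀ x, p (i x) = 0) :
    ∃ (H : Submodule k V) (S : TriSplitting k V B H C), S.inB = i ∧ S.prC = p := by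
  obtain ⟨ρ, hρ⟩ := i.exists_leftInverse_of_injective (LinearMap.ker_eq_bot.mpr hi)
  obtain ⟨s₀, hs₀⟩ := p.exists_rightInverse_of_surjective (LinearMap.range_eq_top.mpr hp)
  have hρ (x) : ρ (i x) = x := LinearMap.congr_fun hρ x
  have hs₀ (x) : p (s₀ x) = x := LinearMap.congr_fun hs₀ x
  -- Correcting the section by its B-component puts its image in ker ρ without changing p ∘ s.
  obtain ⟨s, hs⟩ : ∃ s, s = s₀ - i ∘ₗ ρ ∘ₗ s₀ := ⟨_, rfl⟩
  have hps (x) : p (s x) = x := by simp [hs, hs₀, hpi]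
  have hρs (x) : ρ (s x) = 0 := by simp [hs, hρ]
  let K : Submodule k V := LinearMap.ker ρ ⊓ LinearMap.ker p
  let q : V →ₗ[k] K := LinearMap.codRestrict K (LinearMap.id - i ∘ₗ ρ - s ∘ₗ p) fun x => by
    simp [K, hρ, hps, hρs, hpi]
  have hq (x) : (q x : V) = x - i (ρ x) - s (p x) := rfl
  have hKρ (x : K) : ρ x = 0 := x.2.1
  have hKp (x : K) : p x = 0 := x.2.2
  exact ⟨K, {
    inB := i
    inH := K.subtype
    inC := s
    prB := ρ
    prH := q
    prC := p
    prB_inB := hρ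
    prB_inH := hKρ
    prB_inC := hρs
    prH_inB := fun x => Subtype.ext (by simp [hq, hρ, hpi])
    prH_inH := fun x => Subtype.ext (by simp [hq, hKρ, hKp])
    prH_inC := fun x => Subtype.ext (by simp [hq, hps, hρs])
    prC_inB := hpi
    prC_inH := hKp
    prC_inC := hps
    sum_eq := fun x => by simp only [Submodule.subtype_apply, hq]; abel }, rfl, rfl⟩

end TriSplitting

end Splitting

open CategoryTheory

/-! ### Splitting a complex; traces on coboundaries and cohomology -/

section Complex

variable {k : Type u} [Field k] (V : CochainComplex (ModuleCat.{v} k) ℤ)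

/-- The coboundaries in degree `i`. -/
def coboundaries (i : ℤ) : Submodule k (V.X i) := LinearMap.range (V.d (i - 1) i).hom

lemma range_d {i j : ℤ} (h : i + 1 = j) : LinearMap.range (V.d i j).hom = coboundaries V j := by
  obtain rfl : i = j - 1 := by omega
  rfl

/-- The differential as a map onto the coboundaries. -/
def toCoboundaries (i : ℤ) : V.X i →ₗ[k] coboundaries V (i + 1) :=
  LinearMap.codRestrict _ (V.d i (i + 1)).hom fun x => by
    rw [← range_d V rfl]
    exact LinearMap.mem_range_self _ x

variable {V}

lemma d_d_apply (i j l : ℤ) (x : V.X i) : (V.d j l).hom ((V.d i j).hom x) = 0 := by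
  rw [← LinearMap.comp_apply, ← ModuleCat.hom_comp, V.d_comp_d]
  rfl

lemma d_coboundaries (i : ℤ) (x : coboundaries V i) : (V.d i (i + 1)).hom x = 0 := by
  obtain ⟨x, y, rfl⟩ := x
  exact d_d_apply _ _ _ y

lemma comm_apply (φ : V ⟶ V) (i j : ℤ) (x : V.X i) :
    (φ.f j).hom ((V.d i j).hom x) = (V.d i j).hom ((φ.f i).hom x) := by
  rw [← LinearMap.comp_apply, ← ModuleCat.hom_comp, ← φ.comm, ModuleCat.hom_comp,
    LinearMap.comp_apply]

lemma map_mem_coboundaries (φ : V ⟶ V) (i : ℤ) (x : coboundaries V i) :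
    (φ.f i).hom x ∈ coboundaries V i := by
  obtain ⟨x, y, rfl⟩ := x
  rw [comm_apply]
  exact ⟨_, rfl⟩

/-- The map induced on coboundaries. -/
def coboundariesMap (φ : V ⟶ V) (i : ℤ) : Module.End k (coboundaries V i) :=
  (φ.f i).hom.restrict fun x hx => map_mem_coboundaries φ i ⟨x, hx⟩

@[simp]
lemma coe_coboundariesMap (φ : V ⟶ V) (i : ℤ) (x : coboundaries V i) :
    (coboundariesMap φ i x : V.X i) = (φ.f i).hom x := rfl

variable (V) in
/-- A decomposition of `V i` into coboundaries, a complement of the coboundaries in the cocycles,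
and a complement of the cocycles. -/
structure DegreeSplitting (i : ℤ) where
  H : Submodule k (V.X i)
  toTri : TriSplitting k (V.X i) (coboundaries V i) H (coboundaries V (i + 1))
  inB_eq : toTri.inB = (coboundaries V i).subtype
  prC_eq : toTri.prC = toCoboundaries V i

variable (V) in
lemma nonempty_degreeSplitting (i : ℤ) : Nonempty (DegreeSplitting V i) := by
  obtain ⟨H, S, h1, h2⟩ := TriSplitting.exists_of_comp_eq_zero (coboundaries V i).subtype
    (coboundaries V i).injective_subtype (toCoboundaries V i)
    (fun ⟨y, hy⟩ => by
      rw [← range_d V rfl] at hy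
      obtain ⟨x, hx⟩ := hy
      exact ⟨x, Subtype.ext hx⟩)
    (fun x => Subtype.ext (d_coboundaries i x))
  exact ⟨⟨H, S, h1, h2⟩⟩

namespace DegreeSplitting

variable {i : ℤ} (S : DegreeSplitting V i)

lemma inB_apply (x : coboundaries V i) : S.toTri.inB x = x := by rw [S.inB_eq]; rfl

lemma coe_prC_apply (x : V.X i) :
    (S.toTri.prC x : V.X (i + 1)) = (V.d i (i + 1)).hom x := by rw [S.prC_eq]; rfl

lemma map_inB (φ : V ⟶ V) (x : coboundaries V i) :
    (φ.f i).hom (S.toTri.inB x) = S.toTri.inB (coboundariesMap φ i x) := by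
  simp [inB_apply]

lemma prC_map (φ : V ⟶ V) (x : V.X i) :
    S.toTri.prC ((φ.f i).hom x) = coboundariesMap φ (i + 1) (S.toTri.prC x) := by
  ext
  rw [coe_prC_apply, coe_coboundariesMap, coe_prC_apply, comm_apply]

lemma prB_comp_inB (φ : V ⟶ V) :
    S.toTri.prB ∘ₗ (φ.f i).hom ∘ₗ S.toTri.inB = coboundariesMap φ i := by
  ext1 x
  simp [map_inB]

lemma prC_comp_inC (φ : V ⟶ V) :
    S.toTri.prC ∘ₗ (φ.f i).hom ∘ₗ S.toTri.inC = coboundariesMap φ (i + 1) := by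
  ext1 x
  simp [prC_map]

/-- The inclusion of the complement `H` into cohomology. -/
noncomputable def toHomology : ModuleCat.of k S.H ⟶ V.homology i :=
  V.liftCycles (ModuleCat.ofHom S.toTri.inH) (i + 1) (by simp) (by
    ext x
    exact (S.coe_prC_apply _).symm.trans (congrArg Subtype.val (S.toTri.prC_inH x))) ≫ V.homologyπ i

/-- The projection of cohomology onto the complement `H`. -/
noncomputable def ofHomology : V.homology i ⟶ ModuleCat.of k S.H :=
  V.homologyι i ≫ V.descOpcycles (ModuleCat.ofHom S.toTri.prH) (i - 1) (by simp) (by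
    ext x
    have : S.toTri.prH (S.toTri.inB ⟨(V.d (i - 1) i).hom x, x, rfl⟩) = 0 := S.toTri.prH_inB _
    rw [inB_apply] at this
    exact congrArg Subtype.val this)

lemma toHomology_homologyMap_ofHomology (φ : V ⟶ V) :
    S.toHomology ≫ HomologicalComplex.homologyMap φ i ≫ S.ofHomology =
      ModuleCat.ofHom S.toTri.inH ≫ φ.f i ≫ ModuleCat.ofHom S.toTri.prH := by
  simp [toHomology, ofHomology]

/-- The C-component vanishes on cocycles and the B-component dies modulo coboundaries, so the map
from cycles to opcycles factors through H. -/
lemma ofHomology_toHomology : S.ofHomology ≫ S.toHomology = 𝟙 (V.homology i) := by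
  have h1 : V.iCycles i ≫ ModuleCat.ofHom S.toTri.prC = 0 := by
    ext x
    exact (S.coe_prC_apply _).trans
      (LinearMap.congr_fun (congrArg ModuleCat.Hom.hom (V.iCycles_d i (i + 1))) x)
  have h2 : ModuleCat.ofHom S.toTri.inB ≫ V.pOpcycles i = 0 := by
    ext ⟨x, y, rfl⟩
    have := LinearMap.congr_fun (congrArg ModuleCat.Hom.hom (V.d_pOpcycles (i - 1) i)) y
    change (V.pOpcycles i).hom (S.toTri.inB _) = 0
    rw [inB_apply]
    exact this
  have h3 : 𝟙 (V.X i) = ModuleCat.ofHom S.toTri.prB ≫ ModuleCat.ofHom S.toTri.inB +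
      ModuleCat.ofHom S.toTri.prH ≫ ModuleCat.ofHom S.toTri.inH +
      ModuleCat.ofHom S.toTri.prC ≫ ModuleCat.ofHom S.toTri.inC := by
    ext x
    exact (S.toTri.sum_eq x).symm
  have h4 : V.iCycles i ≫ 𝟙 (V.X i) ≫ V.pOpcycles i = V.iCycles i ≫
      ModuleCat.ofHom S.toTri.prH ≫ ModuleCat.ofHom S.toTri.inH ≫ V.pOpcycles i := by
    rw [h3]
    simp only [Preadditive.add_comp, Preadditive.comp_add, Category.assoc, h2, reassoc_of% h1,
      Limits.comp_zero, Limits.zero_comp, zero_add, add_zero]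
  rw [← cancel_epi (V.homologyπ i), ← cancel_mono (V.homologyι i)]
  simp only [toHomology, ofHomology, Category.assoc, HomologicalComplex.homology_π_ι,
    HomologicalComplex.liftCycles_i_assoc, HomologicalComplex.homology_π_ι_assoc,
    HomologicalComplex.p_descOpcycles_assoc, Category.id_comp, Category.comp_id] at h4 ⊢
  exact h4.symm

/-- By cyclicity of the trace, only one of the two inverse identities between H and cohomology is
needed. -/
lemma trH_eq [FiniteDimensional k (V.X i)] (φ : V ⟶ V) :
    trH φ i = LinearMap.trace k S.H (S.toTri.prH ∘ₗ (φ.f i).hom ∘ₗ S.toTri.inH) := by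
  have h (x) : S.toHomology.hom (S.ofHomology.hom x) = x :=
    LinearMap.congr_fun (congrArg ModuleCat.Hom.hom S.ofHomology_toHomology) x
  have : FiniteDimensional k (V.homology i) :=
    Module.Finite.of_surjective S.toHomology.hom fun x => ⟨_, h x⟩
  have h1 := congrArg ModuleCat.Hom.hom (S.toHomology_homologyMap_ofHomology φ)
  have h2 : S.toTri.prH ∘ₗ (φ.f i).hom ∘ₗ S.toTri.inH =
      (S.ofHomology.hom ∘ₗ (HomologicalComplex.homologyMap φ i).hom) ∘ₗ S.toHomology.hom :=
    h1.symm
  rw [h2, LinearMap.trace_comp_comm']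
  refine congrArg _ (LinearMap.ext fun x => ?_)
  exact (h _).symm

end DegreeSplitting

lemma tr_eq_add [hfin : ∀ i, FiniteDimensional k (V.X i)] (φ : V ⟶ V) (i : ℤ) :
    tr φ i = LinearMap.trace k _ (coboundariesMap φ i) + trH φ i +
      LinearMap.trace k _ (coboundariesMap φ (i + 1)) := by
  obtain ⟨S⟩ := nonempty_degreeSplitting V i
  rw [S.trH_eq, ← S.prB_comp_inB, ← S.prC_comp_inC]
  exact S.toTri.trace_eq _

/-- For a quasi-bounded complex the traces on the terms and on cohomology determine those on the
coboundaries. -/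
lemma trace_coboundariesMap_eq_zero [∀ i, FiniteDimensional k (V.X i)] (hV : IsQuasiBounded V)
    (φ : V ⟶ V) (h : ∀ i, tr φ i = 0 ∧ trH φ i = 0) (i : ℤ) :
    LinearMap.trace k _ (coboundariesMap φ i) = 0 := by
  obtain ⟨j, hj⟩ := hV
  have step (i : ℤ) : LinearMap.trace k _ (coboundariesMap φ i) +
      LinearMap.trace k _ (coboundariesMap φ (i + 1)) = 0 := by
    have := tr_eq_add φ i
    rw [(h i).1, (h i).2, add_zero] at this
    exact this.symm
  -- The zero differential leaving degree j kills the coboundaries in degree j + 1.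
  have base : LinearMap.trace k _ (coboundariesMap φ (j + 1)) = 0 := by
    have : coboundariesMap φ (j + 1) = 0 := by
      ext ⟨x, hx⟩
      rw [← range_d V rfl, hj] at hx
      obtain ⟨y, rfl⟩ := hx
      simp
    rw [this, map_zero]
  induction i using Int.inductionOn' (b := j + 1) with
  | zero => exact base
  | succ i _ ih => simpa [ih] using step i
  | pred i _ ih =>
    have := step (i - 1)
    rw [sub_add_cancel, ih, add_zero] at this
    exact this

/-- Commutation with d only requires that the quotient block in degree i agree with the sub block in
degree i + 1. -/
lemma exists_hom_of_blocks (S : ∀ i, DegreeSplitting V i) (f : ∀ i, Module.End k (V.X i))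
    (Z : ∀ i, Module.End k (coboundaries V i))
    (h : ∀ i x, f i ((S i).toTri.inB x) = (S i).toTri.inB (Z i x))
    (h' : ∀ i x, (S i).toTri.prC (f i x) = Z (i + 1) ((S i).toTri.prC x)) :
    ∃ ψ : V ⟶ V, ∀ i, (ψ.f i).hom = f i := by
  refine ⟨{ f := fun i => ModuleCat.ofHom (f i), comm' := ?_ }, fun i => rfl⟩
  rintro i _ rfl
  ext x
  have h1 := (S i).coe_prC_apply (f i x)
  have h2 := h (i + 1) ((S i).toTri.prC x)
  rw [DegreeSplitting.inB_apply, DegreeSplitting.inB_apply, ← h', DegreeSplitting.coe_prC_apply,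
    DegreeSplitting.coe_prC_apply] at h2
  exact h2.symm

end Complex

/-- Prescribed differences are summed outwards from 0; on each side one of the two sums is empty. -/
lemma exists_forall_sub_succ_eq {G : Type*} [AddCommGroup G] (δ : ℤ → G) :
    ∃ c : ℤ → G, ∀ i, c i - c (i + 1) = δ i := by
  refine ⟨fun i => ∑ j ∈ Finset.Ico i 0, δ j - ∑ j ∈ Finset.Ico 0 i, δ j, fun i => ?_⟩
  beta_reduce
  rcases lt_or_ge i 0 with hi | hi
  · have h1 : ∑ j ∈ Finset.Ico i 0, δ j = δ i + ∑ j ∈ Finset.Ico (i + 1) 0, δ j := by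
      rw [← Finset.insert_Ico_add_one_left_eq_Ico hi, Finset.sum_insert (by simp)]
    rw [h1, Finset.Ico_eq_empty (by omega : ¬ (0 : ℤ) < i),
      Finset.Ico_eq_empty (by omega : ¬ (0 : ℤ) < i + 1)]
    abel
  · have h1 : ∑ j ∈ Finset.Ico 0 (i + 1), δ j = δ i + ∑ j ∈ Finset.Ico 0 i, δ j := by
      rw [← Finset.insert_Ico_right_eq_Ico_add_one hi, Finset.sum_insert (by simp)]
    rw [h1, Finset.Ico_eq_empty (by omega : ¬ (i : ℤ) < 0),
      Finset.Ico_eq_empty (by omega : ¬ (i + 1 : ℤ) < 0)]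
    abel

/-! ### Assembling the commutator -/

section Commutator

variable {k : Type u} [Field k] {V : CochainComplex (ModuleCat.{v} k) ℤ}

/-- Shifting each X_i by c_i affects solvability only through c_i - c_{i+1}. These differences can
be prescribed freely, each outside a finite bad set. -/
lemma exists_commutators_sylvesterSolvable [Infinite k] {E : ℤ → Type*}
    [∀ i, AddCommGroup (E i)] [∀ i, Module k (E i)] [∀ i, FiniteDimensional k (E i)]
    (A : ∀ i, Module.End k (E i)) (hA : ∀ i, LinearMap.trace k _ (A i) = 0) :
    ∃ X Z : ∀ i, Module.End k (E i), (∀ i, A i = X i * Z i - Z i * X i) ∧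
      ∀ i, SylvesterSolvable (X i) (X (i + 1)) := by
  choose X Z hXZ using fun i => isRingCommutator_of_trace_eq_zero (A i) (hA i)
  choose δ hδ using fun i => (finite_not_sylvesterSolvable (X i) (X (i + 1))).exists_notMem
  obtain ⟨c, hc⟩ := exists_forall_sub_succ_eq δ
  refine ⟨fun i => X i + c i • 1, Z, fun i => ?_, fun i => SylvesterSolvable.add_smul_one ?_⟩
  · rw [hXZ]
    simp [add_mul, mul_add]
  · rw [hc]
    exact not_not.mp (hδ i)

/-- The cohomology block meets only the two fixed coboundary blocks of its own degree, so one shift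
avoids both finite bad sets. -/
lemma exists_commutator_sylvesterSolvable [Infinite k] {E F G : Type*}
    [AddCommGroup E] [Module k E] [FiniteDimensional k E]
    [AddCommGroup F] [Module k F] [FiniteDimensional k F]
    [AddCommGroup G] [Module k G] [FiniteDimensional k G]
    (A : Module.End k F) (hA : LinearMap.trace k F A = 0) (X : Module.End k E)
    (X' : Module.End k G) :
    ∃ Y W : Module.End k F, A = Y * W - W * Y ∧ SylvesterSolvable X Y ∧ SylvesterSolvable Y X' := by
  obtain ⟨Y, W, hYW⟩ := isRingCommutator_of_trace_eq_zero A hA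
  obtain ⟨t, ht⟩ := ((finite_not_sylvesterSolvable_right X Y).union
    (finite_not_sylvesterSolvable Y X')).exists_notMem
  rw [Set.mem_union, not_or] at ht
  refine ⟨Y + t • 1, W, ?_, not_not.mp ht.1, not_not.mp ht.2⟩
  rw [hYW]
  simp [add_mul, mul_add]

lemma isCommutator_iff_exists {φ : V ⟶ V} :
    IsCommutator φ ↔ ∃ α β : V ⟶ V, ∀ i, (φ.f i).hom =
      ((α.f i).hom * (β.f i).hom - (β.f i).hom * (α.f i).hom : Module.End k (V.X i)) := by
  refine exists_congr fun α => exists_congr fun β => ⟨?_, fun h => ?_⟩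
  · rintro rfl i
    rfl
  · refine HomologicalComplex.hom_ext _ _ fun i => ModuleCat.hom_ext ?_
    exact h i

lemma IsCommutator.tr_eq_zero {φ : V ⟶ V} (h : IsCommutator φ) (i : ℤ) : tr φ i = 0 := by
  obtain ⟨α, β, h⟩ := isCommutator_iff_exists.mp h
  rw [tr, h i, map_sub, LinearMap.trace_mul_comm, sub_self]

lemma IsCommutator.trH_eq_zero {φ : V ⟶ V} (h : IsCommutator φ) (i : ℤ) : trH φ i = 0 := by
  obtain ⟨α, β, h⟩ := h
  -- Multiplication in `End V` is composition in the reverse of the `≫` order.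
  have h1 : φ = β ≫ α - α ≫ β := h
  rw [trH, h1, HomologicalComplex.homologyMap_sub, HomologicalComplex.homologyMap_comp,
    HomologicalComplex.homologyMap_comp, ModuleCat.hom_sub, ModuleCat.hom_comp, ModuleCat.hom_comp,
    map_sub]
  exact sub_eq_zero.mpr (LinearMap.trace_mul_comm k _ _)

lemma isCommutator_of_trace_eq_zero [Infinite k] [∀ i, FiniteDimensional k (V.X i)] {φ : V ⟶ V}
    (hB : ∀ i, LinearMap.trace k _ (coboundariesMap φ i) = 0) (hH : ∀ i, trH φ i = 0) :
    IsCommutator φ := by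
  have S (i : ℤ) : DegreeSplitting V i := (nonempty_degreeSplitting V i).some
  obtain ⟨X, Z, hXZ, hXX⟩ := exists_commutators_sylvesterSolvable (coboundariesMap φ) hB
  choose Y W hYW hXY hYX using fun i => exists_commutator_sylvesterSolvable
    ((S i).toTri.prH ∘ₗ (φ.f i).hom ∘ₗ (S i).toTri.inH) (((S i).trH_eq φ).symm.trans (hH i))
    (X i) (X (i + 1))
  choose β hβ hβB hβC using fun i => (S i).toTri.exists_eq_diag_commutator (φ.f i).hom
    (fun x => by simp [(S i).map_inB]) (fun x => by simp [(S i).map_inB])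
    (fun x => by simp [(S i).prC_map]) (((S i).prB_comp_inB φ).trans (hXZ i)) (hYW i)
    (((S i).prC_comp_inC φ).trans (hXZ (i + 1))) (hXY i) (hXX i) (hYX i)
  obtain ⟨β', hβ'⟩ := exists_hom_of_blocks S β Z hβB hβC
  -- The same X_{i+1} is used as last block in degree i and first block in degree i + 1, which makes
  -- α a chain map.
  obtain ⟨α', hα'⟩ := exists_hom_of_blocks S
    (fun i => (S i).toTri.diag (X i) (Y i) (X (i + 1))) X
    (fun i x => by simp [TriSplitting.diag]) (fun i x => by simp [TriSplitting.diag])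
  refine isCommutator_iff_exists.mpr ⟨α', β', fun i => ?_⟩
  rw [hα', hβ']
  exact hβ i

end Commutator

end EndComplex

theorem theorem2 {k : Type u} [Field k] [Infinite k]
    (V : CochainComplex (ModuleCat.{v} k) ℤ)
    (hfin : ∀ i : ℤ, FiniteDimensional k (V.X i))
    (hV : EndComplex.IsQuasiBounded V) (φ : V ⟶ V) :
    EndComplex.IsCommutator φ ↔
      ∀ i : ℤ, EndComplex.tr φ i = 0 ∧ EndComplex.trH φ i = 0 := by
  refine ⟨fun h i => ⟨h.tr_eq_zero i, h.trH_eq_zero i⟩, fun h => ?_⟩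
  exact EndComplex.isCommutator_of_trace_eq_zero
    (EndComplex.trace_coboundariesMap_eq_zero hV φ h) fun i => (h i).2
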